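/- Let $r\ge 0$, let $\mathfrak g=\mathfrak{sl}_{r+1}(\mathbb C)$ with Cartan subalgebra $\mathfrak h$ of diagonal matrices, matrix units $x^+_{i,j}=E_{i,j+1}$, $x^-_{i,j}=E_{j+1,i}$ ($1\le i\le j\le r$), $\mathfrak n^+=\bigoplus_{i\le j}\mathbb C x^+_{i,j}$, coroots $h_i=E_{i,i}-E_{i+1,i+1}$, and fundamental weights $\omega_1,\dots,\omega_r\in\mathfrak h^*$ dual to $h_1,\dots,h_r$; let $P^+=\sum_i\mathbb Z_{\ge0}\,\omega_i$. The current algebra $\mathfrak g[t]=\mathfrak g\otimes\mathbb C[t]$ and its enveloping algebra $U(\mathfrak g[t])$ are graded by powers of $t$. For $\lambda=\sum_i m_i\omega_i\in P^+$, let $V(\lambda)$ be the irreducible $\mathfrak g$-module of highest weight $\lambda$, that is, the $\mathfrak g$-module with generator $v_\lambda$ and defining relations $x^+_{i,j}v_\lambda=0$, $hv_\lambda=\lambda(h)v_\lambda$, $(x^-_{i,i})^{m_i+1}v_\lambda=0$ for all $1\le i\le j\le r$ and $h\in\mathfrak h$; for $a\in\mathbb C$ let $V_a(\lambda)$ be its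 pull-back along $\mathfrak g[t]\to\mathfrak g$, $x\otimes t^s\mapsto a^sx$. The Weyl module $W(\lambda)$ is the $\mathfrak g[t]$-module with generator $w_\lambda$ and defining relations $$\mathfrak n^+[t]\,w_\lambda=0,\quad (h\otimes t^s)w_\lambda=0\ (s>0),\quad hw_\lambda=\lambda(h)w_\lambda,\quad (x^-_{i,i}\otimes1)^{m_i+1}w_\lambda=0\qquad(h\in\mathfrak h,\ 1\le i\le r),$$ and $W(\lambda)_s=U(\mathfrak g[t])_s\,w_\lambda$, where $U(\mathfrak g[t])_s$ is the part of grade $s$. Given $k\ge1$, $\lambda_1,\dots,\lambda_k\in P^+$ and distinct $a_1,\dots,a_k\in\mathbb C$, put $\mathbf v=v_{\lambda_1}\otimes\cdots\otimes v_{\lambda_k}\in V_{a_1}(\lambda_1)\otimes\cdots\otimes V_{a_k}(\lambda_k)$, let $V^n$ be the span of the vectors $g\mathbf v$ with $g\in U(\mathfrak g[t])$ of grade at most $n$, and $V^{-1}=0$. The fusion product $V_{a_1}(\lambda_1)*\cdots*V_{a_k}(\lambda_k)$ is the graded space $\bigoplus_{n\ge0}V^n/V^{n-1}$ with the $\mathfrak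 g[t]$-action in which $x\otimes t^s$ maps the class of $v\in V^n$ in $V^n/V^{n-1}$ to the class of $(x\otimes t^s)v$ in $V^{n+s}/V^{n+s-1}$. Put $\lambda=\lambda_1+\cdots+\lambda_k$. Then $V_{a_1}(\lambda_1)*\cdots*V_{a_k}(\lambda_k)$ is a graded quotient of $W(\lambda)$: one has $W(\lambda)=\bigoplus_{s\ge0}W(\lambda)_s$, the fusion product is the direct sum of its graded pieces $V^s/V^{s-1}$, and there is a surjective homomorphism of $\mathfrak g[t]$-modules $W(\lambda)\to V_{a_1}(\lambda_1)*\cdots*V_{a_k}(\lambda_k)$ that sends $w_\lambda$ to the class of $\mathbf v$ in $V^0$ and maps $W(\lambda)_s$ onto $V^s/V^{s-1}$ for every $s\ge0$. -/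

import Mathlib

open scoped TensorProduct DirectSum Polynomial

attribute [local instance 100] LieRing.ofAssociativeRing

noncomputable section

namespace FusionWeyl

/-! ### Cyclic modules given by generators and relations -/

section Cyclic

variable (L : Type) [LieRing L] [LieAlgebra ℂ L]

/-- The universal enveloping algebra over `ℂ`. -/
abbrev U : Type := UniversalEnvelopingAlgebra ℂ L

/-- The inclusion of a Lie algebra in its enveloping algebra. -/
abbrev incl : L →ₗ⁅ℂ⁆ U L := UniversalEnvelopingAlgebra.ι ℂ

/-- The `L`-module with one generator `w` and defining relations `u w = 0`, `u ∈ S`: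
the quotient of `U(L)` by the left ideal generated by `S`. -/
def CyclicModule (S : Set (U L)) : Type := U L ⧸ Submodule.span (U L) S

variable {L} (S : Set (U L))

instance : AddCommGroup (CyclicModule L S) :=
  inferInstanceAs (AddCommGroup (U L ⧸ Submodule.span (U L) S))

instance : Module (U L) (CyclicModule L S) :=
  inferInstanceAs (Module (U L) (U L ⧸ Submodule.span (U L) S))

instance : Module ℂ (CyclicModule L S) :=
  inferInstanceAs (Module ℂ (U L ⧸ Submodule.span (U L) S))

instance : IsScalarTower ℂ (U L) (CyclicModule L S) :=
  inferInstanceAs (IsScalarTower ℂ (U L) (U L ⧸ Submodule.span (U L) S))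

instance : LieRingModule L (CyclicModule L S) where
  bracket x w := incl L x • w
  add_lie x y w := by
    rw [map_add, add_smul]
  lie_add x v w := smul_add _ _ _
  leibniz_lie x y w := by
    change incl L x • incl L y • w = incl L ⁅x, y⁆ • w + incl L y • incl L x • w
    rw [LieHom.map_lie, LieRing.of_associative_ring_bracket, sub_smul, mul_smul, mul_smul,
      sub_add_cancel]

instance : LieModule ℂ L (CyclicModule L S) where
  smul_lie c x w := by
    change incl L (c • x) • w = c • incl L x • w
    rw [map_smul, smul_assoc]
  lie_smul c x w := by
    change incl L x • c • w = c • incl L x • w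
    rw [← algebraMap_smul (U L) c w, ← algebraMap_smul (U L) c (incl L x • w), ← mul_smul,
      ← mul_smul, Algebra.commutes]

/-- The generator of a cyclic module. -/
def CyclicModule.gen : CyclicModule L S := Submodule.Quotient.mk (1 : U L)

end Cyclic

/-! ### The Lie algebra of trace zero matrices and its weights -/

/-- The Lie algebra `𝔤 = 𝔰𝔩_{r+1}(ℂ)`. -/
abbrev G (r : ℕ) : Type := LieAlgebra.SpecialLinear.sl (Fin (r + 1)) ℂ

/-- The Cartan subalgebra of diagonal matrices. -/
def cartan (r : ℕ) : Submodule ℂ (G r) where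
  carrier := {A | A.val.IsDiag}
  add_mem' hA hB := hA.add hB
  zero_mem' := Matrix.isDiag_zero
  smul_mem' c _ hA := hA.smul c

/-- The root vector `x⁺_{i,j}`, `i ≤ j`: the matrix unit in position `(i, j+1)`. -/
def xPlus {r : ℕ} (i j : Fin r) (h : i ≤ j) : G r :=
  LieAlgebra.SpecialLinear.single i.castSucc j.succ
    (Fin.castSucc_lt_succ_iff.mpr h).ne 1

/-- The root vector `x⁻_{i,j}`, `i ≤ j`: the matrix unit in position `(j+1, i)`. -/
def xMinus {r : ℕ} (i j : Fin r) (h : i ≤ j) : G r :=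
  LieAlgebra.SpecialLinear.single j.succ i.castSucc
    (Fin.castSucc_lt_succ_iff.mpr h).ne' 1

/-- The subalgebra `𝔫⁺`, the span of the `x⁺_{i,j}`. -/
def nPlus (r : ℕ) : Submodule ℂ (G r) :=
  Submodule.span ℂ {x | ∃ (i j : Fin r) (h : i ≤ j), x = xPlus i j h}

/-- The coroot `h_i = H_i - H_{i+1}`. -/
def coroot {r : ℕ} (i : Fin r) : cartan r :=
  ⟨LieAlgebra.SpecialLinear.singleSubSingle i.castSucc i.succ 1, by
    intro p q hpq
    simp only [LieAlgebra.SpecialLinear.val_singleSubSingle, Matrix.sub_apply,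
      Matrix.single_apply]
    rw [if_neg (by grind), if_neg (by grind), sub_zero]⟩

/-- The fundamental weight `ω_i`: the sum of the first `i` diagonal entries. -/
def omega {r : ℕ} (i : Fin r) : Module.Dual ℂ (cartan r) where
  toFun A := ∑ p : Fin (r + 1), if p ≤ i.castSucc then A.val.val p p else 0
  map_add' A B := by
    rw [← Finset.sum_add_distrib]
    refine Finset.sum_congr rfl fun p _ => ?_
    split_ifs <;> simp
  map_smul' c A := by
    rw [RingHom.id_apply, Finset.smul_sum]
    refine Finset.sum_congr rfl fun p _ => ?_
    split_ifs <;> simp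

/-- The fundamental weights are dual to the coroots. -/
theorem omega_coroot {r : ℕ} (i j : Fin r) : omega i (coroot j) = if i = j then 1 else 0 := by
  have key : omega i (coroot j) =
      (if j.castSucc ≤ i.castSucc then 1 else 0) - (if j.succ ≤ i.castSucc then 1 else 0) := by
    have h1 : ∀ p : Fin (r + 1), (if p ≤ i.castSucc then (coroot j).val.val p p else 0) =
        (if j.castSucc = p then (if p ≤ i.castSucc then (1 : ℂ) else 0) else 0) -
        (if j.succ = p then (if p ≤ i.castSucc then (1 : ℂ) else 0) else 0) := by
      intro p
      simp only [coroot, LieAlgebra.SpecialLinear.val_singleSubSingle, Matrix.sub_apply,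
        Matrix.single_apply, and_self]
      split_ifs <;> simp
    change (∑ p : Fin (r + 1), if p ≤ i.castSucc then (coroot j).val.val p p else 0) = _
    simp_rw [h1]
    rw [Finset.sum_sub_distrib, Finset.sum_ite_eq, Finset.sum_ite_eq]
    simp
  rw [key]
  simp only [Fin.le_def, Fin.val_castSucc, Fin.val_succ, Fin.ext_iff]
  split_ifs <;> first | omega | simp

/-- Dominant integral weights `∑ m_i ω_i`, recorded by their coefficients `m_i ∈ ℕ`. -/
abbrev DomWeight (r : ℕ) : Type := Fin r → ℕ

/-- The linear form `∑ m_i ω_i` on the Cartan subalgebra. -/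
def DomWeight.toDual {r : ℕ} (m : DomWeight r) : Module.Dual ℂ (cartan r) :=
  ∑ i, m i • omega i

/-- The defining relations of `V(λ)`. -/
inductive IrrRel {r : ℕ} (m : DomWeight r) : U (G r) → Prop
  | raising (i j : Fin r) (h : i ≤ j) : IrrRel m (incl (G r) (xPlus i j h))
  | weight (h : cartan r) :
      IrrRel m (incl (G r) (h : G r) - algebraMap ℂ (U (G r)) (DomWeight.toDual m h))
  | lowering (i : Fin r) : IrrRel m (incl (G r) (xMinus i i le_rfl) ^ (m i + 1))

/-- The irreducible finite-dimensional `𝔤`-module `V(λ)`, by generators and relations. -/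
abbrev V {r : ℕ} (m : DomWeight r) : Type := CyclicModule (G r) {u | IrrRel m u}

/-- The highest weight vector `v_λ`. -/
abbrev V.hw {r : ℕ} (m : DomWeight r) : V m := CyclicModule.gen _

/-! ### The current algebra, its enveloping algebra and Weyl modules -/

/-- The current algebra `𝔤[t]`, with bracket `[f ⊗ x, g ⊗ y] = fg ⊗ [x, y]`. -/
abbrev Cur (r : ℕ) : Type := ℂ[X] ⊗[ℂ] G r

/-- The element `x ⊗ t^s` of the current algebra. -/
def cur {r : ℕ} (s : ℕ) (x : G r) : Cur r := (Polynomial.X ^ s : ℂ[X]) ⊗ₜ[ℂ] x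

/-- The grade `n` part of `U(𝔤[t])`: the span of all products of elements `x_i ⊗ t^{s_i}` with
`∑ s_i = n`. -/
def uGrade (r n : ℕ) : Submodule ℂ (U (Cur r)) :=
  Submodule.span ℂ {u | ∃ l : List (ℕ × G r), (l.map Prod.fst).sum = n ∧
    u = (l.map fun p => incl (Cur r) (cur p.1 p.2)).prod}

/-- The elements of `U(𝔤[t])` of grade at most `n`. -/
def uFilt (r n : ℕ) : Submodule ℂ (U (Cur r)) := ⨆ m ∈ Finset.range (n + 1), uGrade r m

/-- The defining relations of the Weyl module `W(λ)`. -/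
inductive WeylRel {r : ℕ} (m : DomWeight r) : U (Cur r) → Prop
  | raising (f : ℂ[X]) (x : nPlus r) : WeylRel m (incl (Cur r) (f ⊗ₜ[ℂ] (x : G r)))
  | cartan_pos (s : ℕ) (hs : 0 < s) (h : cartan r) : WeylRel m (incl (Cur r) (cur s (h : G r)))
  | weight (h : cartan r) : WeylRel m
      (incl (Cur r) (cur 0 (h : G r)) - algebraMap ℂ (U (Cur r)) (DomWeight.toDual m h))
  | lowering (i : Fin r) : WeylRel m (incl (Cur r) (cur 0 (xMinus i i le_rfl)) ^ (m i + 1))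

/-- The Weyl module `W(λ)`. -/
abbrev Weyl {r : ℕ} (m : DomWeight r) : Type := CyclicModule (Cur r) {u | WeylRel m u}

/-- The generator `w_λ`. -/
abbrev Weyl.gen {r : ℕ} (m : DomWeight r) : Weyl m := CyclicModule.gen _

/-- The grading `W(λ)_s = U(𝔤[t])_s w_λ` induced by that of `𝔤[t]`. -/
def Weyl.grade {r : ℕ} (m : DomWeight r) (s : ℕ) : Submodule ℂ (Weyl m) :=
  (uGrade r s).map ((LinearMap.toSpanSingleton (U (Cur r)) (Weyl m) (Weyl.gen m)).restrictScalars ℂ)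

/-! ### Evaluation modules and their tensor products -/

/-- The evaluation homomorphism `x ⊗ f ↦ f(a) x`. -/
def ev {r : ℕ} (a : ℂ) : Cur r →ₗ⁅ℂ⁆ G r :=
  { TensorProduct.lift
      ((LinearMap.lsmul ℂ (G r)) ∘ₗ (Polynomial.aeval (R := ℂ) a).toLinearMap) with
    map_lie' := by
      intro x y
      simp only [AddHom.toFun_eq_coe, LinearMap.coe_toAddHom]
      induction x using TensorProduct.induction_on with
      | zero => simp
      | add x x' hx hx' => simp only [add_lie, map_add, hx, hx']
      | tmul f x =>
        induction y using TensorProduct.induction_on with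
        | zero => simp
        | add y y' hy hy' => simp only [lie_add, map_add, hy, hy']
        | tmul g y => simp [smul_smul, mul_comm] }

theorem ev_cur {r : ℕ} (a : ℂ) (s : ℕ) (x : G r) : ev a (cur s x) = a ^ s • x := by
  change Polynomial.aeval a (Polynomial.X ^ s : ℂ[X]) • x = _
  simp

/-- The action of `𝔤[t]` on `V_a(λ)`, the pull-back of `V(λ)` through `ev a`. -/
def evalRep {r : ℕ} (a : ℂ) (m : DomWeight r) : Cur r →ₗ⁅ℂ⁆ Module.End ℂ (V m) :=
  (LieModule.toEnd ℂ (G r) (V m)).comp (ev a)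

section Tensor

variable {k : ℕ} {M : Fin k → Type} [∀ i, AddCommGroup (M i)] [∀ i, Module ℂ (M i)]

/-- The operator `1 ⊗ ⋯ ⊗ f ⊗ ⋯ ⊗ 1` with `f` in position `i`. -/
def slot (i : Fin k) : Module.End ℂ (M i) →ₗ[ℂ] Module.End ℂ (⨂[ℂ] j, M j) where
  toFun f := PiTensorProduct.map (Function.update (fun _ => 1) i f)
  map_add' := PiTensorProduct.map_update_add _ i
  map_smul' := PiTensorProduct.map_update_smul _ i

theorem slot_mul (i : Fin k) (f g : Module.End ℂ (M i)) : slot i (f * g) = slot i f * slot i g := by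
  change PiTensorProduct.map _ = PiTensorProduct.map _ * PiTensorProduct.map _
  rw [← PiTensorProduct.map_mul]
  congr 1
  funext j
  rcases eq_or_ne j i with rfl | h
  · simp
  · simp [Function.update_of_ne h]

theorem slot_comm {i j : Fin k} (hij : i ≠ j) (f : Module.End ℂ (M i)) (g : Module.End ℂ (M j)) :
    slot i f * slot j g = slot j g * slot i f := by
  change PiTensorProduct.map _ * PiTensorProduct.map _ =
    PiTensorProduct.map _ * PiTensorProduct.map _
  rw [← PiTensorProduct.map_mul, ← PiTensorProduct.map_mul]
  congr 1
  funext l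
  rcases eq_or_ne l i with rfl | h
  · simp [Function.update_of_ne hij]
  · simp [Function.update_of_ne h]

/-- The tensor product of representations: `x` acts by `∑ i, 1 ⊗ ⋯ ⊗ ρ_i(x) ⊗ ⋯ ⊗ 1`. -/
def tensorRep {L : Type} [LieRing L] [LieAlgebra ℂ L] (ρ : ∀ i, L →ₗ⁅ℂ⁆ Module.End ℂ (M i)) :
    L →ₗ⁅ℂ⁆ Module.End ℂ (⨂[ℂ] j, M j) :=
  { (∑ i, slot i ∘ₗ (ρ i : L →ₗ[ℂ] Module.End ℂ (M i)) : L →ₗ[ℂ] Module.End ℂ (⨂[ℂ] j, M j)) with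
    map_lie' := by
      intro x y
      simp only [AddHom.toFun_eq_coe, LinearMap.coe_toAddHom, LinearMap.sum_apply,
        LinearMap.comp_apply, LieHom.coe_toLinearMap, LieHom.map_lie,
        LieRing.of_associative_ring_bracket, map_sub, slot_mul, Finset.sum_mul_sum]
      rw [Finset.sum_comm (f := fun i j => slot i (ρ i y) * slot j (ρ j x)),
        ← Finset.sum_sub_distrib]
      refine Finset.sum_congr rfl fun i _ => ?_
      rw [← Finset.sum_sub_distrib, Finset.sum_eq_single i]
      · intro j _ hj
        rw [slot_comm hj, sub_self]
      · simp }

end Tensor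

/-! ### Fusion products -/

variable {r k : ℕ} (a : Fin k → ℂ) (m : Fin k → DomWeight r)

/-- The space `V(λ_1) ⊗ ⋯ ⊗ V(λ_k)`. -/
abbrev TensorV : Type := ⨂[ℂ] i, V (m i)

/-- The vector `v_{λ_1} ⊗ ⋯ ⊗ v_{λ_k}`. -/
def topVec : TensorV m := PiTensorProduct.tprod ℂ fun i => V.hw (m i)

/-- The action of `𝔤[t]` on `V_{a_1}(λ_1) ⊗ ⋯ ⊗ V_{a_k}(λ_k)`. -/
def evTensor : Cur r →ₗ⁅ℂ⁆ Module.End ℂ (TensorV m) := tensorRep fun i => evalRep (a i) (m i)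

/-- The extension of this action to `U(𝔤[t])`. -/
def evTensorU : U (Cur r) →ₐ[ℂ] Module.End ℂ (TensorV m) :=
  UniversalEnvelopingAlgebra.lift ℂ (evTensor a m)

/-- The filtration `V^n`: the span of the vectors `g v` with `g ∈ U(𝔤[t])` of grade at most `n`. -/
def filt (n : ℕ) : Submodule ℂ (TensorV m) :=
  Submodule.span ℂ {v | ∃ g ∈ uFilt r n, v = evTensorU a m g (topVec m)}

/-- The subspace `V^{n-1}`, where `V^{-1} = 0`. -/
def filtPred : ℕ → Submodule ℂ (TensorV m)
  | 0 => ⊥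
  | n + 1 => filt a m n

/-- The subquotient `V^n / V^{n-1}`. -/
def GrPiece (n : ℕ) : Type := filt a m n ⧸ (filtPred a m n).submoduleOf (filt a m n)

instance (n : ℕ) : AddCommGroup (GrPiece a m n) :=
  inferInstanceAs (AddCommGroup (filt a m n ⧸ (filtPred a m n).submoduleOf (filt a m n)))

instance (n : ℕ) : Module ℂ (GrPiece a m n) :=
  inferInstanceAs (Module ℂ (filt a m n ⧸ (filtPred a m n).submoduleOf (filt a m n)))

/-- The quotient map `V^n → V^n / V^{n-1}`. -/
def GrPiece.mk (n : ℕ) : filt a m n →ₗ[ℂ] GrPiece a m n :=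
  Submodule.mkQ ((filtPred a m n).submoduleOf (filt a m n))

/-- The underlying space `⨁ n, V^n / V^{n-1}` of the fusion product
`V_{a_1}(λ_1) * ⋯ * V_{a_k}(λ_k)`. -/
def Fusion : Type := ⨁ n, GrPiece a m n

instance : AddCommGroup (Fusion a m) := inferInstanceAs (AddCommGroup (⨁ n, GrPiece a m n))

instance : Module ℂ (Fusion a m) := inferInstanceAs (Module ℂ (⨁ n, GrPiece a m n))

/-- The inclusion of the summand `V^n / V^{n-1}` in the fusion product. -/
def Fusion.of (n : ℕ) : GrPiece a m n →ₗ[ℂ] Fusion a m := DirectSum.lof ℂ ℕ (GrPiece a m) n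

/-- The class in `V^n / V^{n-1}` of a vector of `V^n`. -/
def Fusion.mk (n : ℕ) : filt a m n →ₗ[ℂ] Fusion a m :=
  Fusion.of a m n ∘ₗ GrPiece.mk a m n

/-- The grade `n` part of the fusion product. -/
def Fusion.grade (n : ℕ) : Submodule ℂ (Fusion a m) := LinearMap.range (Fusion.mk a m n)

theorem one_mem_uFilt (r n : ℕ) : (1 : U (Cur r)) ∈ uFilt r n := by
  have h : uGrade r 0 ≤ uFilt r n :=
    le_iSup₂_of_le (f := fun m (_ : m ∈ Finset.range (n + 1)) => uGrade r m) 0 (by simp) le_rfl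
  exact h (Submodule.subset_span ⟨[], by simp⟩)

theorem mul_mem_uFilt {n s : ℕ} (x : G r) {u : U (Cur r)} (hu : u ∈ uFilt r n) :
    incl (Cur r) (cur s x) * u ∈ uFilt r (n + s) := by
  have h : uFilt r n ≤
      (uFilt r (n + s)).comap (LinearMap.mulLeft ℂ (incl (Cur r) (cur s x))) := by
    refine iSup₂_le fun p hp => Submodule.span_le.mpr ?_
    rintro _ ⟨l, hl, rfl⟩
    have h' : uGrade r (s + p) ≤ uFilt r (n + s) :=
      le_iSup₂_of_le (f := fun m (_ : m ∈ Finset.range (n + s + 1)) => uGrade r m) (s + p)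
        (by simp at hp ⊢; omega) le_rfl
    exact h' (Submodule.subset_span ⟨(s, x) :: l, by simp [hl], by simp⟩)
  exact h hu

theorem topVec_mem : topVec m ∈ filt a m 0 :=
  Submodule.subset_span ⟨1, one_mem_uFilt r 0, by simp⟩

/-- `(x ⊗ t^s) V^n ⊆ V^{n+s}`. -/
theorem cur_mem_filt (n s : ℕ) (x : G r) {v : TensorV m} (hv : v ∈ filt a m n) :
    evTensor a m (cur s x) v ∈ filt a m (n + s) := by
  have h : filt a m n ≤ (filt a m (n + s)).comap (evTensor a m (cur s x)) := by
    refine Submodule.span_le.mpr ?_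
    rintro _ ⟨g, hg, rfl⟩
    refine Submodule.subset_span ⟨_, mul_mem_uFilt (s := s) x hg, ?_⟩
    rw [map_mul, Module.End.mul_apply]
    congr 1
    exact (UniversalEnvelopingAlgebra.lift_ι_apply ℂ (evTensor a m) _).symm ▸ rfl
  exact h hv

theorem cur_mem_filtPred (n s : ℕ) (x : G r) {v : TensorV m} (hv : v ∈ filtPred a m n) :
    evTensor a m (cur s x) v ∈ filtPred a m (n + s) := by
  cases n with
  | zero =>
    rw [(Submodule.mem_bot ℂ).mp hv, map_zero]
    exact Submodule.zero_mem _
  | succ n =>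
    rw [Nat.add_right_comm]
    exact cur_mem_filt a m n s x hv

theorem Fusion.mk_eq_zero {n : ℕ} (v : filt a m n) (hv : (v : TensorV m) ∈ filtPred a m n) :
    Fusion.mk a m n v = 0 := by
  have : GrPiece.mk a m n v = 0 := (Submodule.Quotient.mk_eq_zero _).mpr hv
  rw [Fusion.mk, LinearMap.comp_apply, this, map_zero]

theorem Fusion.mk_congr {n n' : ℕ} (h : n = n') {v : filt a m n} {v' : filt a m n'}
    (hv : (v : TensorV m) = v') : Fusion.mk a m n v = Fusion.mk a m n' v' := by
  subst h
  rw [Subtype.ext hv]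

/-- The map `V^n / V^{n-1} → V^{n+s} / V^{n+s-1}` induced by `x ⊗ t^s`. -/
def grAct (s n : ℕ) (x : G r) : GrPiece a m n →ₗ[ℂ] Fusion a m :=
  Submodule.liftQ ((filtPred a m n).submoduleOf (filt a m n))
    (Fusion.mk a m (n + s) ∘ₗ (evTensor a m (cur s x)).restrict
      fun _ hv => cur_mem_filt a m n s x hv)
    fun _ hv => Fusion.mk_eq_zero a m _ (cur_mem_filtPred a m n s x hv)

/-- The operator by which `x ⊗ t^s` acts on the fusion product. -/
def curAct (s : ℕ) (x : G r) : Module.End ℂ (Fusion a m) :=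
  DirectSum.toModule ℂ ℕ (Fusion a m) fun n => grAct a m s n x

theorem curAct_mk (s n : ℕ) (x : G r) (v : filt a m n) :
    curAct a m s x (Fusion.mk a m n v) =
      Fusion.mk a m (n + s) ⟨evTensor a m (cur s x) v, cur_mem_filt a m n s x v.2⟩ := by
  change DirectSum.toModule ℂ ℕ (Fusion a m) (fun n => grAct a m s n x)
    (DirectSum.lof ℂ ℕ (GrPiece a m) n _) = _
  rw [DirectSum.toModule_lof]
  rfl

theorem Fusion.end_ext {f g : Module.End ℂ (Fusion a m)}
    (h : ∀ n v, f (Fusion.mk a m n v) = g (Fusion.mk a m n v)) : f = g := by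
  refine DirectSum.linearMap_ext ℂ fun n => ?_
  refine Submodule.linearMap_qext ((filtPred a m n).submoduleOf (filt a m n))
    (LinearMap.ext fun v => ?_)
  exact h n v

theorem cur_add (s : ℕ) (x y : G r) : cur s (x + y) = cur s x + cur s y :=
  TensorProduct.tmul_add _ _ _

theorem cur_smul (s : ℕ) (c : ℂ) (x : G r) : cur s (c • x) = c • cur s x :=
  TensorProduct.tmul_smul _ _ _

theorem cur_lie (s s' : ℕ) (x y : G r) : ⁅cur s x, cur s' y⁆ = cur (s + s') ⁅x, y⁆ := by
  simp [cur, pow_add]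

theorem evTensor_cur_add (s : ℕ) (x y : G r) (v : TensorV m) :
    evTensor a m (cur s (x + y)) v = evTensor a m (cur s x) v + evTensor a m (cur s y) v := by
  rw [cur_add, map_add, LinearMap.add_apply]

theorem evTensor_cur_smul (s : ℕ) (c : ℂ) (x : G r) (v : TensorV m) :
    evTensor a m (cur s (c • x)) v = c • evTensor a m (cur s x) v := by
  rw [cur_smul, map_smul, LinearMap.smul_apply]

theorem curAct_add (s : ℕ) (x y : G r) :
    curAct a m s (x + y) = curAct a m s x + curAct a m s y := by
  refine Fusion.end_ext a m fun n v => ?_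
  rw [LinearMap.add_apply, curAct_mk, curAct_mk, curAct_mk]
  refine Eq.trans ?_ ((Fusion.mk a m (n + s)).map_add _ _)
  exact Fusion.mk_congr a m rfl (evTensor_cur_add a m s x y v)

theorem curAct_smul (s : ℕ) (c : ℂ) (x : G r) :
    curAct a m s (c • x) = c • curAct a m s x := by
  refine Fusion.end_ext a m fun n v => ?_
  rw [LinearMap.smul_apply, curAct_mk, curAct_mk]
  refine Eq.trans ?_ ((Fusion.mk a m (n + s)).map_smul _ _)
  exact Fusion.mk_congr a m rfl (evTensor_cur_smul a m s c x v)

/-- `curAct` as a linear map in `x`. -/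
def curActLin (s : ℕ) : G r →ₗ[ℂ] Module.End ℂ (Fusion a m) where
  toFun := curAct a m s
  map_add' := curAct_add a m s
  map_smul' := curAct_smul a m s

theorem curAct_lie (s s' : ℕ) (x y : G r) :
    curAct a m (s + s') ⁅x, y⁆ = ⁅curAct a m s x, curAct a m s' y⁆ := by
  refine Fusion.end_ext a m fun n v => ?_
  rw [LieRing.of_associative_ring_bracket, LinearMap.sub_apply, Module.End.mul_apply,
    Module.End.mul_apply, curAct_mk, curAct_mk, curAct_mk, curAct_mk, curAct_mk,
    Fusion.mk_congr a m (n := n + s' + s) (n' := n + (s + s')) (by omega)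
      (v' := ⟨evTensor a m (cur s x) (evTensor a m (cur s' y) v), by
        have := cur_mem_filt a m _ s x (cur_mem_filt a m n s' y v.2)
        rwa [show n + s' + s = n + (s + s') by omega] at this⟩) rfl,
    Fusion.mk_congr a m (n := n + s + s') (n' := n + (s + s')) (by omega)
      (v' := ⟨evTensor a m (cur s' y) (evTensor a m (cur s x) v), by
        have := cur_mem_filt a m _ s' y (cur_mem_filt a m n s x v.2)
        rwa [show n + s + s' = n + (s + s') by omega] at this⟩) rfl, ← map_sub]
  refine Fusion.mk_congr a m rfl ?_
  simp [← cur_lie, LieHom.map_lie, LieRing.of_associative_ring_bracket]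

/-- The linear map `𝔤[t] → End` with `x ⊗ t^s ↦ curAct s x`. -/
def fusionLin : Cur r →ₗ[ℂ] Module.End ℂ (Fusion a m) :=
  TensorProduct.lift ((Polynomial.basisMonomials ℂ).constr ℂ fun s => curActLin a m s)

theorem fusionLin_cur (s : ℕ) (x : G r) : fusionLin a m (cur s x) = curAct a m s x := by
  rw [fusionLin, cur, TensorProduct.lift.tmul,
    show (Polynomial.X ^ s : ℂ[X]) = Polynomial.basisMonomials ℂ s by
      simp [Polynomial.X_pow_eq_monomial], Module.Basis.constr_basis]
  rfl

theorem cur_induction {p : Cur r → Prop} (z : Cur r) (h0 : p 0)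
    (ha : ∀ z z', p z → p z' → p (z + z')) (hc : ∀ s x, p (cur s x)) : p z := by
  induction z using TensorProduct.induction_on with
  | zero => exact h0
  | add z z' hz hz' => exact ha z z' hz hz'
  | tmul f x =>
    induction f using Polynomial.induction_on' with
    | add f g hf hg => rw [TensorProduct.add_tmul]; exact ha _ _ hf hg
    | monomial s c =>
      have : (Polynomial.monomial s c : ℂ[X]) ⊗ₜ[ℂ] x = cur s (c • x) := by
        rw [cur, TensorProduct.tmul_smul, TensorProduct.smul_tmul', Polynomial.X_pow_eq_monomial,
          Polynomial.smul_monomial, smul_eq_mul, mul_one]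
      rw [this]
      exact hc s _

/-- The action of `𝔤[t]` on the fusion product. -/
def fusionRep : Cur r →ₗ⁅ℂ⁆ Module.End ℂ (Fusion a m) :=
  { fusionLin a m with
    map_lie' := by
      intro z w
      simp only [AddHom.toFun_eq_coe, LinearMap.coe_toAddHom]
      induction z using cur_induction with
      | h0 => simp
      | ha z z' hz hz' => simp only [add_lie, map_add, hz, hz']
      | hc s x =>
        induction w using cur_induction with
        | h0 => simp
        | ha w w' hw hw' => simp only [lie_add, map_add, hw, hw']
        | hc s' y => rw [cur_lie, fusionLin_cur, fusionLin_cur, fusionLin_cur, curAct_lie] }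

instance : LieRingModule (Cur r) (Fusion a m) where
  bracket z w := fusionRep a m z w
  add_lie z z' w := by
    change fusionRep a m (z + z') w = fusionRep a m z w + fusionRep a m z' w
    rw [map_add, LinearMap.add_apply]
  lie_add z w w' := map_add (fusionRep a m z) w w'
  leibniz_lie z z' w := by
    change fusionRep a m z (fusionRep a m z' w) =
      fusionRep a m ⁅z, z'⁆ w + fusionRep a m z' (fusionRep a m z w)
    rw [LieHom.map_lie, LieRing.of_associative_ring_bracket, LinearMap.sub_apply,
      Module.End.mul_apply, Module.End.mul_apply, sub_add_cancel]

instance : LieModule ℂ (Cur r) (Fusion a m) where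
  smul_lie c z w := by
    change fusionRep a m (c • z) w = c • fusionRep a m z w
    rw [map_smul, LinearMap.smul_apply]
  lie_smul c z w := map_smul (fusionRep a m z) c w

/-- The formula `(x ⊗ t^s) v̄ = class of (x ⊗ t^s) v` that characterizes the action. -/
theorem Fusion.cur_lie_mk (s n : ℕ) (x : G r) (v : filt a m n) :
    ⁅cur s x, Fusion.mk a m n v⁆ =
      Fusion.mk a m (n + s) ⟨evTensor a m (cur s x) v, cur_mem_filt a m n s x v.2⟩ := by
  change fusionLin a m (cur s x) _ = _
  rw [fusionLin_cur, curAct_mk]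

/-- The class of `v_{λ_1} ⊗ ⋯ ⊗ v_{λ_k}` in grade `0`. -/
def Fusion.topClass : Fusion a m := Fusion.mk a m 0 ⟨topVec m, topVec_mem a m⟩

end FusionWeyl

end

noncomputable section

namespace FusionWeyl

/-! ### The universal property of cyclic modules -/

section Cyclic

variable {L : Type} [LieRing L] [LieAlgebra ℂ L] {S : Set (U L)}

/-! The grading of `W(λ)` comes from homogeneous relations. Since the bracket adds powers of `t`,
the assignment `x ⊗ t^s ↦ (x ⊗ t^s) X^s` extends to an algebra homomorphism `coact : U(𝔤[t]) →
U(𝔤[t])[X]`, and it sends `u` of grade `n` to `u X^n`. Its coefficients therefore pick out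
homogeneous components, with no need for a PBW basis. The relations of `W(λ)` are sums of
homogeneous relations, so the left ideal they generate is stable under taking coefficients
(`coeff_coact_mem_span_weylRel`). The coefficient maps then descend to projections of `W(λ)` onto
its graded pieces.

For the homomorphism, it suffices that the class of `𝐯` satisfies the relations of `W(λ)`. An
element `u` of grade `n` sends this class to the class of `u 𝐯` in `V^n/V^{n-1}`
(`fusionRepU_topClass`), so a relation holds as soon as `u 𝐯 ∈ V^{n-1}`. Raising operators kill `𝐯`.
The element `h ⊗ t^s` multiplies `𝐯` by `∑ a_i^s λ_i(h)`: for `s = 0` this is `λ(h)`, and for `s >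
0` the result lies in `V^0 ⊆ V^{s-1}`. The lowering operator is a sum of commuting operators, one
per tensor factor, and the binomial theorem bounds the power that kills `𝐯`.

Finally `V^n` is contained in `V^{n-1} + U(𝔤[t])_n 𝐯` (`filt_le_sup`), which gives surjectivity in
each grade. -/

theorem CyclicModule.smul_gen (u : U L) :
    u • CyclicModule.gen S = (Submodule.Quotient.mk u : U L ⧸ Submodule.span (U L) S) := by
  change (Submodule.Quotient.mk (u • (1 : U L)) : U L ⧸ Submodule.span (U L) S) = _
  rw [smul_eq_mul, mul_one]

theorem CyclicModule.exists_smul_gen (w : CyclicModule L S) :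
    ∃ u : U L, u • CyclicModule.gen S = w := by
  obtain ⟨u, hu⟩ := Submodule.Quotient.mk_surjective (Submodule.span (U L) S) w
  exact ⟨u, (CyclicModule.smul_gen u).trans hu⟩

theorem CyclicModule.smul_gen_eq_zero {u : U L} :
    u • CyclicModule.gen S = 0 ↔ u ∈ Submodule.span (U L) S := by
  rw [CyclicModule.smul_gen]
  exact Submodule.Quotient.mk_eq_zero _

theorem CyclicModule.incl_smul (x : L) (w : CyclicModule L S) : incl L x • w = ⁅x, w⁆ := rfl

/-- A linear map out of a cyclic module, from one on `U(L)` that kills the left ideal of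
relations. -/
def CyclicModule.liftLin {M : Type*} [AddCommGroup M] [Module ℂ M] (f : U L →ₗ[ℂ] M)
    (hf : ∀ u ∈ Submodule.span (U L) S, f u = 0) : CyclicModule L S →ₗ[ℂ] M :=
  (((Submodule.span (U L) S).restrictScalars ℂ).liftQ f hf) ∘ₗ
    (Submodule.Quotient.restrictScalarsEquiv ℂ (Submodule.span (U L) S)).symm.toLinearMap

theorem CyclicModule.liftLin_smul_gen {M : Type*} [AddCommGroup M] [Module ℂ M]
    (f : U L →ₗ[ℂ] M) (hf : ∀ u ∈ Submodule.span (U L) S, f u = 0) (u : U L) :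
    CyclicModule.liftLin f hf (u • CyclicModule.gen S) = f u := by
  rw [CyclicModule.smul_gen]
  rfl

/-- A vector that satisfies the defining relations of a cyclic module is the image of its
generator. -/
def CyclicModule.lift {M : Type*} [AddCommGroup M] [Module ℂ M] [LieRingModule L M]
    [LieModule ℂ L M] (v : M)
    (hv : ∀ u ∈ S, UniversalEnvelopingAlgebra.lift ℂ (LieModule.toEnd ℂ L M) u v = 0) :
    CyclicModule L S →ₗ⁅ℂ, L⁆ M :=
  -- The elements that annihilate `v` form a left ideal, so it is enough that this ideal contains
  -- `S`.
  have hf : ∀ u ∈ Submodule.span (U L) S, (LinearMap.applyₗ v ∘ₗ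
      (UniversalEnvelopingAlgebra.lift ℂ (LieModule.toEnd ℂ L M)).toLinearMap) u = 0 := by
    intro u hu
    induction hu using Submodule.span_induction with
    | mem u hu => exact hv u hu
    | zero => exact map_zero _
    | add u u' _ _ hu hu' => rw [map_add, hu, hu', add_zero]
    | smul c u _ hu =>
      simp only [LinearMap.comp_apply, AlgHom.toLinearMap_apply, LinearMap.applyₗ_apply_apply]
        at hu ⊢
      rw [smul_eq_mul, map_mul, Module.End.mul_apply, hu, map_zero]
  { CyclicModule.liftLin _ hf with
    map_lie' := by
      intro x w
      obtain ⟨u, rfl⟩ := CyclicModule.exists_smul_gen w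
      simp only [AddHom.toFun_eq_coe, LinearMap.coe_toAddHom]
      rw [← CyclicModule.incl_smul, ← mul_smul, CyclicModule.liftLin_smul_gen,
        CyclicModule.liftLin_smul_gen]
      simp }

theorem CyclicModule.lift_smul_gen {M : Type*} [AddCommGroup M] [Module ℂ M] [LieRingModule L M]
    [LieModule ℂ L M] (v : M)
    (hv : ∀ u ∈ S, UniversalEnvelopingAlgebra.lift ℂ (LieModule.toEnd ℂ L M) u v = 0) (u : U L) :
    CyclicModule.lift v hv (u • CyclicModule.gen S) =
      UniversalEnvelopingAlgebra.lift ℂ (LieModule.toEnd ℂ L M) u v :=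
  CyclicModule.liftLin_smul_gen _ _ u

end Cyclic

/-! ### The grading of the enveloping algebra of the current algebra -/

variable {r : ℕ}

theorem one_mem_uGrade : (1 : U (Cur r)) ∈ uGrade r 0 :=
  Submodule.subset_span ⟨[], by simp⟩

theorem incl_cur_mem_uGrade (s : ℕ) (x : G r) : incl (Cur r) (cur s x) ∈ uGrade r s :=
  Submodule.subset_span ⟨[(s, x)], by simp⟩

theorem mul_mem_uGrade {n p : ℕ} {u v : U (Cur r)} (hu : u ∈ uGrade r n) (hv : v ∈ uGrade r p) :
    u * v ∈ uGrade r (n + p) := by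
  have h := Submodule.mul_mem_mul hu hv
  rw [uGrade, uGrade, Submodule.span_mul_span] at h
  refine Submodule.span_mono ?_ h
  rintro _ ⟨_, ⟨l, hl, rfl⟩, _, ⟨l', hl', rfl⟩, rfl⟩
  exact ⟨l ++ l', by simp [hl, hl'], by simp⟩

theorem pow_mem_uGrade_zero {u : U (Cur r)} (hu : u ∈ uGrade r 0) (n : ℕ) :
    u ^ n ∈ uGrade r 0 := by
  induction n with
  | zero =>
    rw [pow_zero]
    exact one_mem_uGrade
  | succ n ih =>
    rw [pow_succ]
    exact mul_mem_uGrade (n := 0) (p := 0) ih hu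

theorem incl_cur_sub_algebraMap_mem_uGrade (x : G r) (c : ℂ) :
    incl (Cur r) (cur 0 x) - algebraMap ℂ (U (Cur r)) c ∈ uGrade r 0 := by
  refine Submodule.sub_mem _ (incl_cur_mem_uGrade _ _) ?_
  rw [Algebra.algebraMap_eq_smul_one]
  exact Submodule.smul_mem _ _ one_mem_uGrade

/-- The linear map `𝔤[t] → U(𝔤[t])[X]` with `x ⊗ t^s ↦ (x ⊗ t^s) X^s`. -/
def coactLin (r : ℕ) : Cur r →ₗ[ℂ] (U (Cur r))[X] :=
  TensorProduct.lift ((Polynomial.basisMonomials ℂ).constr ℂ fun s =>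
    ((Polynomial.monomial s).restrictScalars ℂ ∘ₗ (incl (Cur r) : Cur r →ₗ[ℂ] U (Cur r))) ∘ₗ
      TensorProduct.mk ℂ ℂ[X] (G r) (Polynomial.X ^ s))

theorem coactLin_cur (s : ℕ) (x : G r) :
    coactLin r (cur s x) = Polynomial.monomial s (incl (Cur r) (cur s x)) := by
  rw [coactLin, cur, TensorProduct.lift.tmul]
  nth_rewrite 1 [show (Polynomial.X ^ s : ℂ[X]) = Polynomial.basisMonomials ℂ s by
      simp [Polynomial.X_pow_eq_monomial]]
  rw [Module.Basis.constr_basis]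
  rfl

/-- The homomorphism of Lie algebras `𝔤[t] → U(𝔤[t])[X]` with `x ⊗ t^s ↦ (x ⊗ t^s) X^s`. -/
def coactLie (r : ℕ) : Cur r →ₗ⁅ℂ⁆ (U (Cur r))[X] :=
  { coactLin r with
    map_lie' := by
      intro z w
      simp only [AddHom.toFun_eq_coe, LinearMap.coe_toAddHom]
      induction z using cur_induction with
      | h0 => simp
      | ha z z' hz hz' => simp only [add_lie, map_add, hz, hz']
      | hc s x =>
        induction w using cur_induction with
        | h0 => simp
        | ha w w' hw hw' => simp only [lie_add, map_add, hw, hw']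
        | hc s' y =>
          -- Both sides are monomials of degree `s + s'` whose coefficient is the commutator in the
          -- enveloping algebra.
          rw [cur_lie, coactLin_cur, coactLin_cur, coactLin_cur, ← cur_lie, LieHom.map_lie,
            LieRing.of_associative_ring_bracket, LieRing.of_associative_ring_bracket,
            Polynomial.monomial_mul_monomial, Polynomial.monomial_mul_monomial, map_sub,
            add_comm s' s] }

/-- The coaction of `ℂ[X]` on `U(𝔤[t])` that multiplies an element of grade `n` by `X^n`. -/
def coact (r : ℕ) : U (Cur r) →ₐ[ℂ] (U (Cur r))[X] :=
  UniversalEnvelopingAlgebra.lift ℂ (coactLie r)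

theorem coact_incl_cur (s : ℕ) (x : G r) :
    coact r (incl (Cur r) (cur s x)) = Polynomial.monomial s (incl (Cur r) (cur s x)) :=
  (UniversalEnvelopingAlgebra.lift_ι_apply ℂ (coactLie r) _).trans (coactLin_cur s x)

/-- Multiplicativity of `coact` adds up the exponents along a product of generators. This is what
makes coefficients of `coact` act as projections to the grades. -/
theorem coact_of_mem_uGrade {n : ℕ} {u : U (Cur r)} (hu : u ∈ uGrade r n) :
    coact r u = Polynomial.monomial n u := by
  induction hu using Submodule.span_induction with
  | mem u hu =>
    obtain ⟨l, rfl, rfl⟩ := hu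
    induction l with
    | nil => simp [Polynomial.monomial_zero_left]
    | cons p l ih =>
      simp only [List.map_cons, List.prod_cons, List.sum_cons, map_mul, ih, coact_incl_cur,
        Polynomial.monomial_mul_monomial]
  | zero => simp
  | add u u' _ _ hu hu' => rw [map_add, map_add, hu, hu']
  | smul c u _ hu => rw [map_smul, hu, Polynomial.smul_monomial]

/-- The sum of the grades is a subalgebra that contains the image of `𝔤[t]`, and that image
generates the enveloping algebra. -/
theorem iSup_uGrade (r : ℕ) : ⨆ n, uGrade r n = ⊤ := by
  have hle (n : ℕ) : uGrade r n ≤ ⨆ n, uGrade r n := le_iSup (uGrade r) n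
  let A : Subalgebra ℂ (U (Cur r)) := (⨆ n, uGrade r n).toSubalgebra
    (hle 0 one_mem_uGrade) (by
      intro u v hu hv
      have h := Submodule.mul_mem_mul hu hv
      rw [Submodule.iSup_mul] at h
      refine (iSup_le fun n => ?_ : (_ : Submodule ℂ (U (Cur r))) ≤ _) h
      rw [Submodule.mul_iSup]
      refine iSup_le fun p => Submodule.mul_le.mpr fun u hu v hv => ?_
      exact hle _ (mul_mem_uGrade hu hv))
  have hA (z : Cur r) : incl (Cur r) z ∈ A := by
    induction z using cur_induction with
    | h0 => rw [map_zero]; exact A.zero_mem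
    | ha z z' hz hz' => rw [map_add]; exact A.add_mem hz hz'
    | hc s x => exact hle s (incl_cur_mem_uGrade s x)
  let g : Cur r →ₗ⁅ℂ⁆ A :=
    { ((incl (Cur r) : Cur r →ₗ[ℂ] U (Cur r)).codRestrict (Subalgebra.toSubmodule A) hA) with
      map_lie' := by
        intro z w
        exact Subtype.ext (LieHom.map_lie (incl (Cur r)) z w) }
  -- By the uniqueness of lifts, the identity factors through `A`, so `A` is everything.
  have hid : A.val.comp (UniversalEnvelopingAlgebra.lift ℂ g) = AlgHom.id ℂ _ := by
    refine UniversalEnvelopingAlgebra.hom_ext ℂ (LieHom.ext fun z => ?_)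
    change ((UniversalEnvelopingAlgebra.lift ℂ g (incl (Cur r) z) : A) : U (Cur r)) =
      incl (Cur r) z
    rw [UniversalEnvelopingAlgebra.lift_ι_apply]
    rfl
  refine eq_top_iff.mpr fun u _ => ?_
  have h := DFunLike.congr_fun hid u
  rw [AlgHom.id_apply] at h
  rw [← h]
  exact (UniversalEnvelopingAlgebra.lift ℂ g u).2

/-- A family of submodules with projections that separate them is independent. -/
theorem iSupIndep_of_projections {M : Type*} [AddCommGroup M] [Module ℂ M]
    {N : ℕ → Submodule ℂ M} (π : ℕ → M →ₗ[ℂ] M) (h : ∀ n, ∀ v ∈ N n, π n v = v)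
    (h' : ∀ n p, p ≠ n → ∀ v ∈ N p, π n v = 0) : iSupIndep N := by
  refine fun n => Submodule.disjoint_def.mpr fun v hv hv' => ?_
  have hle : ⨆ p, ⨆ (_ : p ≠ n), N p ≤ LinearMap.ker (π n) :=
    iSup₂_le fun p hp v hv => h' n p hp v hv
  rw [← h n v hv]
  exact hle hv'

/-! ### The grading of the Weyl module -/

theorem monomial_tmul (s : ℕ) (c : ℂ) (x : G r) :
    (Polynomial.monomial s c : ℂ[X]) ⊗ₜ[ℂ] x = cur s (c • x) := by
  rw [cur, TensorProduct.tmul_smul, TensorProduct.smul_tmul', Polynomial.X_pow_eq_monomial,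
    Polynomial.smul_monomial, smul_eq_mul, mul_one]

/-- A homogeneous relation has itself as its only nonzero coefficient. Only the raising relations,
with an arbitrary polynomial `f`, can be inhomogeneous; splitting `f` into monomials splits them
into homogeneous relations. -/
theorem WeylRel.coeff_coact_mem {m : DomWeight r} {u : U (Cur r)} (hu : WeylRel m u) (n : ℕ) :
    (coact r u).coeff n ∈ Submodule.span (U (Cur r)) {u | WeylRel m u} := by
  have homog {d : ℕ} {u : U (Cur r)} (h : u ∈ uGrade r d)
      (hu : u ∈ Submodule.span (U (Cur r)) {u | WeylRel m u}) :
      (coact r u).coeff n ∈ Submodule.span (U (Cur r)) {u | WeylRel m u} := by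
    rw [coact_of_mem_uGrade h, Polynomial.coeff_monomial]
    split_ifs
    · exact hu
    · exact Submodule.zero_mem _
  cases hu with
  | raising f x =>
    induction f using Polynomial.induction_on' with
    | add f g hf hg =>
      rw [TensorProduct.add_tmul, map_add, map_add, Polynomial.coeff_add]
      exact Submodule.add_mem _ hf hg
    | monomial s c =>
      refine homog (d := s) ?_ (Submodule.subset_span (.raising _ x))
      rw [monomial_tmul]
      exact incl_cur_mem_uGrade _ _
  | cartan_pos s hs h =>
    exact homog (incl_cur_mem_uGrade _ _) (Submodule.subset_span (.cartan_pos s hs h))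
  | weight h =>
    exact homog (incl_cur_sub_algebraMap_mem_uGrade _ _) (Submodule.subset_span (.weight h))
  | lowering i =>
    exact homog (pow_mem_uGrade_zero (incl_cur_mem_uGrade _ _) _) (Submodule.subset_span (.lowering i))

/-- The left ideal of relations is graded: a coefficient of `coact (c * u)` is a sum of left
multiples of coefficients of `coact u`. This is what `Weyl.proj` needs to be well defined. -/
theorem coeff_coact_mem_span_weylRel {m : DomWeight r} {u : U (Cur r)}
    (hu : u ∈ Submodule.span (U (Cur r)) {u | WeylRel m u}) (n : ℕ) :
    (coact r u).coeff n ∈ Submodule.span (U (Cur r)) {u | WeylRel m u} := by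
  induction hu using Submodule.span_induction generalizing n with
  | mem u hu => exact WeylRel.coeff_coact_mem hu n
  | zero => simp
  | add u u' _ _ hu hu' =>
    rw [map_add, Polynomial.coeff_add]
    exact Submodule.add_mem _ (hu n) (hu' n)
  | smul c u _ hu =>
    rw [smul_eq_mul, map_mul, Polynomial.coeff_mul]
    exact Submodule.sum_mem _ fun p _ => Submodule.smul_mem _ _ (hu p.2)

/-- The projection of `W(λ)` to `W(λ)_n`. -/
def Weyl.proj (m : DomWeight r) (n : ℕ) : Weyl m →ₗ[ℂ] Weyl m :=
  CyclicModule.liftLin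
    ((LinearMap.toSpanSingleton (U (Cur r)) (Weyl m) (Weyl.gen m)).restrictScalars ℂ ∘ₗ
      (Polynomial.lcoeff (U (Cur r)) n).restrictScalars ℂ ∘ₗ (coact r).toLinearMap)
    fun _ hu => CyclicModule.smul_gen_eq_zero.mpr (coeff_coact_mem_span_weylRel hu n)

theorem Weyl.proj_smul_gen (m : DomWeight r) (n : ℕ) (u : U (Cur r)) :
    Weyl.proj m n (u • Weyl.gen m) = (coact r u).coeff n • Weyl.gen m :=
  CyclicModule.liftLin_smul_gen _ _ u

theorem Weyl.iSup_grade (m : DomWeight r) : ⨆ s, Weyl.grade m s = ⊤ := by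
  simp only [Weyl.grade]
  rw [← Submodule.map_iSup, iSup_uGrade, Submodule.map_top, LinearMap.range_eq_top]
  exact CyclicModule.exists_smul_gen

theorem Weyl.isInternal_grade (m : DomWeight r) : DirectSum.IsInternal (Weyl.grade m) := by
  refine DirectSum.isInternal_submodule_of_iSupIndep_of_iSup_eq_top
    (iSupIndep_of_projections (Weyl.proj m) ?_ ?_) (Weyl.iSup_grade m)
  · rintro n _ ⟨u, hu, rfl⟩
    change Weyl.proj m n (u • Weyl.gen m) = u • Weyl.gen m
    rw [Weyl.proj_smul_gen, coact_of_mem_uGrade hu, Polynomial.coeff_monomial, if_pos rfl]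
  · rintro n p hp _ ⟨u, hu, rfl⟩
    change Weyl.proj m n (u • Weyl.gen m) = 0
    rw [Weyl.proj_smul_gen, coact_of_mem_uGrade hu, Polynomial.coeff_monomial, if_neg hp,
      zero_smul]

/-! ### The grading of the fusion product -/

section Fusion

variable {k : ℕ} (a : Fin k → ℂ) (m : Fin k → DomWeight r)

theorem Fusion.grade_eq_range_of (n : ℕ) :
    Fusion.grade a m n = LinearMap.range (Fusion.of a m n) := by
  have h : LinearMap.range (GrPiece.mk a m n) = ⊤ := Submodule.range_mkQ _
  rw [Fusion.grade, Fusion.mk, LinearMap.range_comp, h, Submodule.map_top]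

theorem Fusion.isInternal_grade : DirectSum.IsInternal (Fusion.grade a m) := by
  refine DirectSum.isInternal_submodule_of_iSupIndep_of_iSup_eq_top
    (iSupIndep_of_projections
      (fun n => Fusion.of a m n ∘ₗ DirectSum.component ℂ ℕ (GrPiece a m) n) ?_ ?_) ?_
  · intro n v hv
    rw [Fusion.grade_eq_range_of] at hv
    obtain ⟨v, rfl⟩ := hv
    exact congrArg (Fusion.of a m n) (DirectSum.component.lof_self ℂ n v)
  · intro n p hp v hv
    rw [Fusion.grade_eq_range_of] at hv
    obtain ⟨v, rfl⟩ := hv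
    refine (congrArg (Fusion.of a m n) ?_).trans (map_zero _)
    exact DFinsupp.single_eq_of_ne hp.symm
  · refine Submodule.eq_top_iff'.mpr fun v => ?_
    induction v using DirectSum.induction_on with
    | zero => exact Submodule.zero_mem _
    | of n v =>
      refine Submodule.mem_iSup_of_mem n ?_
      rw [Fusion.grade_eq_range_of]
      exact ⟨v, rfl⟩
    | add v w hv hw => exact Submodule.add_mem _ hv hw

/-! ### Relations satisfied by the tensor product of highest weight vectors -/

theorem evTensor_cur (s : ℕ) (x : G r) :
    evTensor a m (cur s x) =
      ∑ i, slot i (a i ^ s • LieModule.toEnd ℂ (G r) (V (m i)) x) := by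
  change (∑ i, slot i ∘ₗ (evalRep (a i) (m i) : Cur r →ₗ[ℂ] Module.End ℂ (V (m i)))) (cur s x) = _
  rw [LinearMap.sum_apply]
  refine Finset.sum_congr rfl fun i _ => ?_
  rw [LinearMap.comp_apply, LieHom.coe_toLinearMap, evalRep, LieHom.comp_apply, ev_cur, map_smul]

theorem slot_apply_tprod {M : Fin k → Type} [∀ i, AddCommGroup (M i)] [∀ i, Module ℂ (M i)]
    (i : Fin k) (f : Module.End ℂ (M i)) (v : ∀ j, M j) :
    slot i f (PiTensorProduct.tprod ℂ v) =
      PiTensorProduct.tprod ℂ (Function.update v i (f (v i))) := by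
  change PiTensorProduct.map _ _ = _
  rw [PiTensorProduct.map_tprod]
  congr 1
  funext j
  rcases eq_or_ne j i with rfl | h
  · simp
  · simp [Function.update_of_ne h]

theorem slot_topVec_of_eq_smul (i : Fin k) {f : Module.End ℂ (V (m i))} {c : ℂ}
    (hf : f (V.hw (m i)) = c • V.hw (m i)) : slot i f (topVec m) = c • topVec m := by
  rw [topVec, slot_apply_tprod, hf, MultilinearMap.map_update_smul, Function.update_eq_self]

theorem slot_pow {M : Fin k → Type} [∀ i, AddCommGroup (M i)] [∀ i, Module ℂ (M i)]
    (i : Fin k) (f : Module.End ℂ (M i)) (n : ℕ) : slot i (f ^ n) = slot i f ^ n := by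
  induction n with
  | zero =>
    rw [pow_zero, pow_zero]
    change PiTensorProduct.map _ = _
    rw [show Function.update (fun j => (1 : Module.End ℂ (M j))) i 1 = fun _ => 1 from
      Function.update_eq_self _ _]
    exact PiTensorProduct.map_one
  | succ n ih => rw [pow_succ, pow_succ, slot_mul, ih]

theorem V.xPlus_hw (m : DomWeight r) (i j : Fin r) (h : i ≤ j) : ⁅xPlus i j h, V.hw m⁆ = 0 := by
  rw [← CyclicModule.incl_smul, CyclicModule.smul_gen_eq_zero]
  exact Submodule.subset_span (.raising i j h)

theorem V.nPlus_hw (m : DomWeight r) {x : G r} (hx : x ∈ nPlus r) : ⁅x, V.hw m⁆ = 0 := by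
  induction hx using Submodule.span_induction with
  | mem x hx =>
    obtain ⟨i, j, h, rfl⟩ := hx
    exact V.xPlus_hw m i j h
  | zero => exact zero_lie _
  | add x y _ _ hx hy => rw [add_lie, hx, hy, add_zero]
  | smul c x _ hx => rw [smul_lie, hx, smul_zero]

theorem V.cartan_hw (m : DomWeight r) (h : cartan r) :
    ⁅(h : G r), V.hw m⁆ = DomWeight.toDual m h • V.hw m := by
  rw [← CyclicModule.incl_smul, ← sub_eq_zero, ← algebraMap_smul (U (G r)) _ (V.hw m), ← sub_smul,
    CyclicModule.smul_gen_eq_zero]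
  exact Submodule.subset_span (.weight h)

theorem V.xMinus_pow_hw (m : DomWeight r) (i : Fin r) :
    (LieModule.toEnd ℂ (G r) (V m) (xMinus i i le_rfl) ^ (m i + 1)) (V.hw m) = 0 := by
  have key (x : G r) (n : ℕ) (v : V m) :
      (LieModule.toEnd ℂ (G r) (V m) x ^ n) v = incl (G r) x ^ n • v := by
    induction n with
    | zero => simp
    | succ n ih =>
      rw [pow_succ', Module.End.mul_apply, ih, pow_succ', mul_smul]
      rfl
  rw [key, CyclicModule.smul_gen_eq_zero]
  exact Submodule.subset_span (.lowering i)

/-- In each binomial term `A ^ n * B ^ (p + q + 1 - n)`, either `n ≥ p + 1` or the exponent of `B`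
is at least `q + 1`. -/
theorem pow_add_apply_eq_zero_of_commute {M : Type*} [AddCommGroup M] [Module ℂ M]
    {A B : Module.End ℂ M} (hAB : Commute A B) {v : M} {p q : ℕ} (hA : (A ^ (p + 1)) v = 0)
    (hB : (B ^ (q + 1)) v = 0) : ((A + B) ^ (p + q + 1)) v = 0 := by
  rw [hAB.add_pow, LinearMap.sum_apply]
  refine Finset.sum_eq_zero fun n hn => ?_
  rw [Finset.mem_range] at hn
  -- The binomial coefficient is moved to the left, so that it is applied after the powers of `A`
  -- and `B`.
  rw [(Nat.cast_commute _ _).symm.eq, Module.End.mul_apply]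
  suffices h : (A ^ n * B ^ (p + q + 1 - n)) v = 0 by rw [h, map_zero]
  rcases Nat.lt_or_ge p n with h | h
  · rw [(hAB.pow_pow _ _).eq, show n = n - (p + 1) + (p + 1) by omega, pow_add A,
      Module.End.mul_apply, Module.End.mul_apply, hA, map_zero, map_zero]
  · rw [show p + q + 1 - n = p - n + (q + 1) by omega, pow_add B, Module.End.mul_apply,
      Module.End.mul_apply, hB, map_zero, map_zero]

theorem pow_sum_apply_eq_zero_of_commute {ι M : Type*} [AddCommGroup M] [Module ℂ M]
    (s : Finset ι) {A : ι → Module.End ℂ M} (hA : ∀ i j, Commute (A i) (A j)) {v : M} {p : ι → ℕ}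
    (h : ∀ i, (A i ^ (p i + 1)) v = 0) : ((∑ i ∈ s, A i) ^ (∑ i ∈ s, p i + 1)) v = 0 := by
  classical
  induction s using Finset.induction_on with
  | empty => simp
  | insert i s hi ih =>
    rw [Finset.sum_insert hi, Finset.sum_insert hi]
    exact pow_add_apply_eq_zero_of_commute (Commute.sum_right _ _ _ fun j _ => hA i j) (h i) ih

/-- In slot `i` the element `x ⊗ t^s` acts as `a_i^s x`. The case `c = 0` covers `𝔫⁺`, and `c i =
λ_i(h)` covers the Cartan subalgebra. -/
theorem evTensor_cur_topVec_of_eq_smul (s : ℕ) {x : G r} {c : Fin k → ℂ}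
    (h : ∀ i, ⁅x, V.hw (m i)⁆ = c i • V.hw (m i)) :
    evTensor a m (cur s x) (topVec m) = (∑ i, a i ^ s * c i) • topVec m := by
  rw [evTensor_cur, LinearMap.sum_apply, Finset.sum_smul]
  refine Finset.sum_congr rfl fun i _ => slot_topVec_of_eq_smul m i ?_
  rw [LinearMap.smul_apply, LieModule.toEnd_apply_apply, h, smul_smul]

theorem evTensor_cur_nPlus_topVec (s : ℕ) {x : G r} (hx : x ∈ nPlus r) :
    evTensor a m (cur s x) (topVec m) = 0 := by
  rw [evTensor_cur_topVec_of_eq_smul a m s (c := fun _ => 0) fun i => by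
    rw [V.nPlus_hw _ hx, zero_smul]]
  simp

theorem DomWeight.toDual_sum (h : cartan r) :
    DomWeight.toDual (∑ i, m i) h = ∑ i, DomWeight.toDual (m i) h := by
  simp only [DomWeight.toDual, LinearMap.sum_apply, LinearMap.smul_apply, Finset.sum_apply,
    Finset.sum_smul]
  exact Finset.sum_comm

theorem evTensor_cur_zero_cartan_topVec (h : cartan r) :
    evTensor a m (cur 0 (h : G r)) (topVec m) =
      DomWeight.toDual (∑ i, m i) h • topVec m := by
  rw [evTensor_cur_topVec_of_eq_smul a m 0 fun i => V.cartan_hw (m i) h, DomWeight.toDual_sum]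
  simp

/-- Operators in different slots commute, and the one in slot `j` kills the vector at the power `m j
i + 1`. -/
theorem evTensor_cur_zero_xMinus_pow_topVec (i : Fin r) :
    (evTensor a m (cur 0 (xMinus i i le_rfl)) ^ ((∑ j, m j) i + 1)) (topVec m) = 0 := by
  rw [evTensor_cur, Finset.sum_apply]
  simp only [pow_zero, one_smul]
  refine pow_sum_apply_eq_zero_of_commute _ (fun j l => ?_) fun j => ?_
  · rcases eq_or_ne j l with rfl | h
    · exact Commute.refl _
    · exact slot_comm h _ _
  · rw [← slot_pow, slot_topVec_of_eq_smul m j (c := 0), zero_smul]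
    rw [V.xMinus_pow_hw, zero_smul]

/-! ### The action of homogeneous elements on the fusion product -/

theorem evTensorU_incl (z : Cur r) : evTensorU a m (incl (Cur r) z) = evTensor a m z :=
  UniversalEnvelopingAlgebra.lift_ι_apply ℂ (evTensor a m) z

theorem uGrade_le_uFilt {p n : ℕ} (h : p ≤ n) : uGrade r p ≤ uFilt r n :=
  le_iSup₂_of_le (f := fun m (_ : m ∈ Finset.range (n + 1)) => uGrade r m) p
    (Finset.mem_range.mpr (by omega)) le_rfl

theorem evTensorU_mem_filt {n : ℕ} {u : U (Cur r)} (hu : u ∈ uFilt r n) :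
    evTensorU a m u (topVec m) ∈ filt a m n :=
  Submodule.subset_span ⟨u, hu, rfl⟩

theorem topVec_mem_filt (n : ℕ) : topVec m ∈ filt a m n := by
  simpa using evTensorU_mem_filt a m (one_mem_uFilt r n)

theorem evTensorU_mem_filtPred {p n : ℕ} (h : p < n) {u : U (Cur r)} (hu : u ∈ uGrade r p) :
    evTensorU a m u (topVec m) ∈ filtPred a m n := by
  cases n with
  | zero => omega
  | succ n => exact evTensorU_mem_filt a m (uGrade_le_uFilt (by omega) hu)

/-- All grades below `n` contribute only to `V^{n-1}`, so modulo it only elements of grade exactly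
`n` matter. -/
theorem filt_le_sup (n : ℕ) : filt a m n ≤ filtPred a m n ⊔
    (uGrade r n).map (LinearMap.applyₗ (topVec m) ∘ₗ (evTensorU a m).toLinearMap) := by
  refine Submodule.span_le.mpr ?_
  rintro _ ⟨g, hg, rfl⟩
  have h : uFilt r n ≤ (filtPred a m n ⊔
      (uGrade r n).map (LinearMap.applyₗ (topVec m) ∘ₗ (evTensorU a m).toLinearMap)).comap
        (LinearMap.applyₗ (topVec m) ∘ₗ (evTensorU a m).toLinearMap) := by
    refine iSup₂_le fun p hp u hu => ?_
    rcases (Nat.lt_succ_iff.mp (Finset.mem_range.mp hp)).lt_or_eq with hp | rfl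
    · exact Submodule.mem_sup_left (evTensorU_mem_filtPred a m hp hu)
    · exact Submodule.mem_sup_right ⟨u, hu, rfl⟩
  exact h hg

/-- The action of `U(𝔤[t])` on the fusion product. -/
def fusionRepU : U (Cur r) →ₐ[ℂ] Module.End ℂ (Fusion a m) :=
  UniversalEnvelopingAlgebra.lift ℂ (LieModule.toEnd ℂ (Cur r) (Fusion a m))

theorem fusionRepU_incl (z : Cur r) (v : Fusion a m) :
    fusionRepU a m (incl (Cur r) z) v = ⁅z, v⁆ :=
  DFunLike.congr_fun (UniversalEnvelopingAlgebra.lift_ι_apply ℂ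
    (LieModule.toEnd ℂ (Cur r) (Fusion a m)) z) v

/-- By induction on the factors: each `x ⊗ t^s` acts on classes through representatives and raises
the grade by `s`. -/
theorem fusionRepU_prod_topClass (l : List (ℕ × G r)) :
    ∃ h : evTensorU a m (l.map fun p => incl (Cur r) (cur p.1 p.2)).prod (topVec m) ∈
        filt a m (l.map Prod.fst).sum,
      fusionRepU a m (l.map fun p => incl (Cur r) (cur p.1 p.2)).prod (Fusion.topClass a m) =
        Fusion.mk a m (l.map Prod.fst).sum ⟨_, h⟩ := by
  have hmem (l : List (ℕ × G r)) :
      evTensorU a m (l.map fun p => incl (Cur r) (cur p.1 p.2)).prod (topVec m) ∈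
        filt a m (l.map Prod.fst).sum :=
    evTensorU_mem_filt a m (uGrade_le_uFilt le_rfl (Submodule.subset_span ⟨l, rfl, rfl⟩))
  refine ⟨hmem l, ?_⟩
  induction l with
  | nil =>
    simp only [List.map_nil, List.prod_nil, map_one, Module.End.one_apply]
    exact Fusion.mk_congr a m rfl (by simp)
  | cons p l ih =>
    simp only [List.map_cons, List.prod_cons, map_mul, Module.End.mul_apply]
    rw [ih, fusionRepU_incl, Fusion.cur_lie_mk]
    refine Fusion.mk_congr a m (by simp [add_comm]) ?_
    simp only [evTensorU_incl]

theorem fusionRepU_topClass {n : ℕ} {u : U (Cur r)} (hu : u ∈ uGrade r n) :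
    fusionRepU a m u (Fusion.topClass a m) =
      Fusion.mk a m n ⟨_, evTensorU_mem_filt a m (uGrade_le_uFilt le_rfl hu)⟩ := by
  -- The membership becomes part of the claim because span induction has to supply it anew for every
  -- intermediate element.
  suffices H : ∃ h : evTensorU a m u (topVec m) ∈ filt a m n,
      fusionRepU a m u (Fusion.topClass a m) = Fusion.mk a m n ⟨_, h⟩ from H.2
  induction hu using Submodule.span_induction with
  | mem u hu =>
    obtain ⟨l, rfl, rfl⟩ := hu
    exact fusionRepU_prod_topClass a m l
  | zero =>
    refine ⟨by simp, ?_⟩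
    rw [map_zero, LinearMap.zero_apply, eq_comm]
    exact (congrArg (Fusion.mk a m n) (Subtype.ext (by simp))).trans (map_zero _)
  | add u u' _ _ hu hu' =>
    obtain ⟨hu, e⟩ := hu
    obtain ⟨hu', e'⟩ := hu'
    have h : evTensorU a m (u + u') (topVec m) =
        evTensorU a m u (topVec m) + evTensorU a m u' (topVec m) := by
      rw [map_add, LinearMap.add_apply]
    refine ⟨by rw [h]; exact Submodule.add_mem _ hu hu', ?_⟩
    rw [map_add, LinearMap.add_apply, e, e']
    exact ((Fusion.mk a m n).map_add _ _).symm.trans (Fusion.mk_congr a m rfl h.symm)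
  | smul c u _ hu =>
    obtain ⟨hu, e⟩ := hu
    have h : evTensorU a m (c • u) (topVec m) = c • evTensorU a m u (topVec m) := by
      rw [map_smul (evTensorU a m) c u, LinearMap.smul_apply]
    refine ⟨by rw [h]; exact Submodule.smul_mem _ c hu, ?_⟩
    rw [map_smul (fusionRepU a m) c u, LinearMap.smul_apply, e]
    exact ((Fusion.mk a m n).map_smul _ _).symm.trans (Fusion.mk_congr a m rfl h.symm)

/-- The criterion by which every relation is checked. In grade `0` it demands `u 𝐯 = 0`, since
`V^{-1} = 0`; in positive grade it suffices to land one step lower in the filtration. -/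
theorem fusionRepU_topClass_eq_zero {n : ℕ} {u : U (Cur r)} (hu : u ∈ uGrade r n)
    (h : evTensorU a m u (topVec m) ∈ filtPred a m n) :
    fusionRepU a m u (Fusion.topClass a m) = 0 := by
  rw [fusionRepU_topClass a m hu]
  exact Fusion.mk_eq_zero a m _ h

/-! ### The homomorphism from the Weyl module to the fusion product -/

/-- The class of `v_{λ_1} ⊗ ⋯ ⊗ v_{λ_k}` satisfies the defining relations of `W(λ)`. -/
theorem fusionRepU_weylRel {u : U (Cur r)} (hu : WeylRel (∑ i, m i) u) :
    fusionRepU a m u (Fusion.topClass a m) = 0 := by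
  cases hu with
  | raising f x =>
    induction f using Polynomial.induction_on' with
    | add f g hf hg =>
      rw [TensorProduct.add_tmul, map_add, map_add, LinearMap.add_apply, hf, hg, add_zero]
    | monomial s c =>
      rw [monomial_tmul]
      refine fusionRepU_topClass_eq_zero a m (incl_cur_mem_uGrade _ _) ?_
      rw [evTensorU_incl, evTensor_cur_nPlus_topVec a m s (Submodule.smul_mem _ c x.2)]
      exact Submodule.zero_mem _
  | cartan_pos s hs h =>
    refine fusionRepU_topClass_eq_zero a m (incl_cur_mem_uGrade _ _) ?_
    rw [evTensorU_incl, evTensor_cur_topVec_of_eq_smul a m s fun i => V.cartan_hw (m i) h]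
    -- The eigenvalue `∑ a_i^s λ_i(h)` may be nonzero. With `s = 0 + n + 1`, the term `V^{s-1}` is
    -- `V^{0+n}`, which contains every multiple of `𝐯`.
    obtain ⟨n, rfl⟩ := Nat.exists_eq_add_of_lt hs
    exact Submodule.smul_mem _ _ (topVec_mem_filt a m (0 + n))
  | weight h =>
    refine fusionRepU_topClass_eq_zero a m (incl_cur_sub_algebraMap_mem_uGrade _ _) ?_
    rw [map_sub, LinearMap.sub_apply, evTensorU_incl, evTensor_cur_zero_cartan_topVec,
      AlgHom.commutes, Module.algebraMap_end_apply, sub_self]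
    exact Submodule.zero_mem _
  | lowering i =>
    refine fusionRepU_topClass_eq_zero a m
      (pow_mem_uGrade_zero (incl_cur_mem_uGrade _ _) _) ?_
    rw [map_pow, evTensorU_incl, evTensor_cur_zero_xMinus_pow_topVec]
    exact Submodule.zero_mem _

/-- The homomorphism from `W(λ)` to the fusion product that maps `w_λ` to the class of
`v_{λ_1} ⊗ ⋯ ⊗ v_{λ_k}`. -/
def weylToFusion : Weyl (∑ i, m i) →ₗ⁅ℂ, Cur r⁆ Fusion a m :=
  CyclicModule.lift (Fusion.topClass a m) fun _ hu => fusionRepU_weylRel a m hu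

theorem weylToFusion_smul_gen (u : U (Cur r)) :
    weylToFusion a m (u • Weyl.gen (∑ i, m i)) = fusionRepU a m u (Fusion.topClass a m) :=
  CyclicModule.lift_smul_gen _ _ u

theorem weylToFusion_gen : weylToFusion a m (Weyl.gen (∑ i, m i)) = Fusion.topClass a m := by
  rw [← one_smul (U (Cur r)) (Weyl.gen (∑ i, m i)), weylToFusion_smul_gen, map_one,
    Module.End.one_apply]

theorem map_weylToFusion_grade (s : ℕ) :
    (Weyl.grade (∑ i, m i) s).map
      (weylToFusion a m : Weyl (∑ i, m i) →ₗ[ℂ] Fusion a m) = Fusion.grade a m s := by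
  apply le_antisymm
  · rintro _ ⟨_, ⟨u, hu, rfl⟩, rfl⟩
    change weylToFusion a m (u • Weyl.gen (∑ i, m i)) ∈ _
    rw [weylToFusion_smul_gen, fusionRepU_topClass a m hu]
    exact ⟨_, rfl⟩
  · rintro _ ⟨v, rfl⟩
    -- Here `v = p + u 𝐯` with `p ∈ V^{s-1}` and `u` of grade `s`, so `u w_λ` is a preimage of the
    -- class of `v`.
    obtain ⟨p, hp, _, ⟨u, hu, rfl⟩, hv⟩ := Submodule.mem_sup.mp (filt_le_sup a m s v.2)
    refine ⟨u • Weyl.gen (∑ i, m i), ⟨u, hu, rfl⟩, ?_⟩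
    change weylToFusion a m (u • Weyl.gen (∑ i, m i)) = _
    rw [weylToFusion_smul_gen, fusionRepU_topClass a m hu, eq_comm, ← sub_eq_zero, ← map_sub]
    refine Fusion.mk_eq_zero a m _ ?_
    rw [Submodule.coe_sub, ← hv]
    simpa using hp

theorem weylToFusion_surjective : Function.Surjective (weylToFusion a m) := by
  have h : LinearMap.range (weylToFusion a m : Weyl (∑ i, m i) →ₗ[ℂ] Fusion a m) = ⊤ := by
    rw [eq_top_iff, ← (Fusion.isInternal_grade a m).submodule_iSup_eq_top]
    refine iSup_le fun s => ?_
    rw [← map_weylToFusion_grade]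
    exact LinearMap.map_le_range
  exact LinearMap.range_eq_top.mp h

end Fusion

end FusionWeyl

end

open FusionWeyl in
theorem proposition1p3p4 (r k : ℕ) (hk : 0 < k) (m : Fin k → DomWeight r) (a : Fin k → ℂ)
    (ha : Function.Injective a) :
    DirectSum.IsInternal (Weyl.grade (∑ i, m i)) ∧
    DirectSum.IsInternal (Fusion.grade a m) ∧
    ∃ f : Weyl (∑ i, m i) →ₗ⁅ℂ, Cur r⁆ Fusion a m,
      Function.Surjective f ∧
      f (Weyl.gen (∑ i, m i)) = Fusion.topClass a m ∧
      ∀ s : ℕ, (Weyl.grade (∑ i, m i) s).map (f : Weyl (∑ i, m i) →ₗ[ℂ] Fusion a m) =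
        Fusion.grade a m s :=
  ⟨Weyl.isInternal_grade _, Fusion.isInternal_grade a m, weylToFusion a m,
    weylToFusion_surjective a m, weylToFusion_gen a m, map_weylToFusion_grade a m⟩
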